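/- Let $N$ be a connected nilpotent Lie group, i.e. a connected finite-dimensional real smooth Lie group whose underlying abstract group is nilpotent. Then every compact subgroup $K$ of $N$ is central in $N$, i.e. $K \subseteq Z(N)$. -/

import Mathlib

open scoped Manifold ContDiff

/-! For `k` in `K`, the commutator map `y ↦ k * y * k⁻¹ * y⁻¹` has derivative `Ad k - 1` at the
identity. Nilpotency of the group makes an iterate of this map trivial, so `Ad k` is unipotent.
Compactness of `K` bounds the powers `Ad k ^ m = Ad (k ^ m)`, and a unipotent element with bounded
powers is `1`. The commutator map then has zero derivative at `1`, by translation everywhere, so on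
a connected group it is constant. -/

theorem eq_zero_of_isNilpotent_of_bddAbove_norm_one_add_pow {R : Type*} [NormedRing R]
    [NormedAlgebra ℝ R] {a : R} (ha : IsNilpotent a) {C : ℝ} (hC : ∀ m : ℕ, ‖(1 + a) ^ m‖ ≤ C) :
    a = 0 := by
  have key : ∀ j : ℕ, a ^ (j + 2) = 0 → a ^ (j + 1) = 0 := by
    intro j hj
    -- Multiplying by `a ^ j` kills all binomial terms beyond the linear one, leaving linear growth
    -- in `m`.
    have expand : ∀ m : ℕ, a ^ j * (1 + a) ^ m = a ^ j + (m : ℝ) • a ^ (j + 1) := by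
      intro m
      induction m with
      | zero => simp
      | succ m ih =>
        rw [pow_succ, ← mul_assoc, ih, mul_add, mul_one, add_mul, smul_mul_assoc, ← pow_succ,
          ← pow_succ, hj]
        push_cast
        rw [add_smul, one_smul, smul_zero]
        abel
    by_contra hne
    have hpos : 0 < ‖a ^ (j + 1)‖ := norm_pos_iff.mpr hne
    obtain ⟨m, hm⟩ := exists_nat_gt ((‖a ^ j‖ * C + ‖a ^ j‖) / ‖a ^ (j + 1)‖)
    rw [div_lt_iff₀ hpos] at hm
    have h1 : (m : ℝ) * ‖a ^ (j + 1)‖ ≤ ‖a ^ j‖ * C + ‖a ^ j‖ := by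
      calc (m : ℝ) * ‖a ^ (j + 1)‖ = ‖(m : ℝ) • a ^ (j + 1)‖ := by simp [norm_smul]
        _ = ‖a ^ j * (1 + a) ^ m - a ^ j‖ := by rw [expand]; congr 1; abel
        _ ≤ ‖a ^ j * (1 + a) ^ m‖ + ‖a ^ j‖ := norm_sub_le _ _
        _ ≤ ‖a ^ j‖ * C + ‖a ^ j‖ := by
          gcongr
          exact (norm_mul_le _ _).trans (by gcongr; exact hC m)
    exact absurd hm (not_lt.mpr h1)
  obtain ⟨c, hc⟩ := ha
  have down : ∀ j : ℕ, a ^ (j + 1) = 0 → a = 0 := by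
    intro j
    induction j with
    | zero => simp
    | succ j ih => exact fun h ↦ ih (key j h)
  exact down c (by rw [pow_succ, hc, zero_mul])

theorem iterate_mul_conj_inv_eq_one {G : Type*} [Group G] [Group.IsNilpotent G] (k x : G) :
    (fun y ↦ k * y * k⁻¹ * y⁻¹)^[Group.nilpotencyClass G] x = 1 := by
  have h : ∀ n, (fun y ↦ k * y * k⁻¹ * y⁻¹)^[n] x ∈ (⊤ : Subgroup G).lowerCentralSeries n := by
    intro n
    induction n with
    | zero => simp
    | succ n ih =>
      rw [Function.iterate_succ_apply', Subgroup.lowerCentralSeries, Subgroup.commutator_comm]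
      exact Subgroup.commutator_mem_commutator (Subgroup.mem_top k) ih
  simpa [Subgroup.lowerCentralSeries_nilpotencyClass] using h (Group.nilpotencyClass G)

section

variable {E : Type*} [NormedAddCommGroup E] [NormedSpace ℝ E]
  {H : Type*} [TopologicalSpace H] {I : ModelWithCorners ℝ E H}
  {F : Type*} [NormedAddCommGroup F] [NormedSpace ℝ F]
  {H' : Type*} [TopologicalSpace H'] {J : ModelWithCorners ℝ F H'}
  {M : Type*} [TopologicalSpace M] [ChartedSpace H M]
  {M' : Type*} [TopologicalSpace M'] [ChartedSpace H' M']

/-- Read in charts, `f` has zero derivative on a ball, which is convex, so the mean value inequality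
applies. -/
theorem IsLocallyConstant.of_hasMFDerivAt_zero [I.Boundaryless] [IsManifold I 1 M]
    [IsManifold J 1 M'] {f : M → M'} (hf : ∀ x, HasMFDerivAt I J f x 0) :
    IsLocallyConstant f := by
  rw [IsLocallyConstant.iff_eventually_eq]
  intro x
  set φ := extChartAt I x
  set ψ := extChartAt J (f x)
  have hs : φ.target ∩ φ.symm ⁻¹' (f ⁻¹' ψ.source) ∈ nhds (φ x) := by
    refine Filter.inter_mem (extChartAt_target_mem_nhds x) ?_
    refine (continuousAt_extChartAt_symm x).preimage_mem_nhds ?_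
    rw [extChartAt_to_inv]
    exact (hf x).continuousAt.preimage_mem_nhds (extChartAt_source_mem_nhds (f x))
  obtain ⟨r, hr, hball⟩ := Metric.mem_nhds_iff.mp hs
  have hder : ∀ y ∈ Metric.ball (φ x) r, HasFDerivAt (ψ ∘ f ∘ φ.symm) (0 : E →L[ℝ] F) y := by
    intro y hy
    obtain ⟨hyt, hys⟩ := hball hy
    have h1 : MDifferentiableAt 𝓘(ℝ, E) I φ.symm y := by
      have := mdifferentiableWithinAt_extChartAt_symm hyt
      rwa [I.range_eq_univ, mdifferentiableWithinAt_univ] at this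
    have h2 : MDifferentiableAt J 𝓘(ℝ, F) ψ (f (φ.symm y)) :=
      mdifferentiableAt_extChartAt (by simpa [ψ] using hys)
    refine HasMFDerivAt.hasFDerivAt ?_
    have h3 := (hf (φ.symm y)).comp y h1.hasMFDerivAt
    rw [ContinuousLinearMap.zero_comp] at h3
    have h4 := HasMFDerivAt.comp y h2.hasMFDerivAt h3
    rw [ContinuousLinearMap.comp_zero] at h4
    exact h4
  have hconst : ∀ y ∈ Metric.ball (φ x) r, f (φ.symm y) = f x := by
    intro y hy
    have h0 := Metric.mem_ball_self (x := φ x) hr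
    have := (convex_ball (φ x) r).is_const_of_fderivWithin_eq_zero (𝕜 := ℝ)
      (fun z hz ↦ (hder z hz).differentiableAt.differentiableWithinAt)
      (fun z hz ↦ by
        rw [fderivWithin_of_isOpen Metric.isOpen_ball hz, (hder z hz).fderiv]) hy h0
    have := ψ.injOn (hball hy).2 (hball h0).2 this
    rwa [extChartAt_to_inv] at this
  filter_upwards [(continuousAt_extChartAt x).preimage_mem_nhds (Metric.ball_mem_nhds (φ x) hr),
    extChartAt_source_mem_nhds (I := I) x] with y hy hys
  simpa [φ.left_inv hys] using hconst (φ y) hy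

end

section

variable {E : Type*} [NormedAddCommGroup E] [NormedSpace ℝ E]
  {H : Type*} [TopologicalSpace H] {I : ModelWithCorners ℝ E H}
  {G : Type*} [TopologicalSpace G] [ChartedSpace H G] [Group G]

variable (I) in
/-- `f` fixes the identity and has derivative `A` there, as an endomorphism of the model space. -/
def HasDerivAtOne (f : G → G) (A : E →L[ℝ] E) : Prop :=
  f 1 = 1 ∧ @HasMFDerivAt ℝ _ E _ _ H _ I G _ _ E _ _ H _ I G _ _ f 1 A

theorem HasDerivAtOne.unique {f : G → G} {A B : E →L[ℝ] E} (hA : HasDerivAtOne I f A)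
    (hB : HasDerivAtOne I f B) : A = B :=
  hasMFDerivAt_unique hA.2 hB.2

theorem HasDerivAtOne.id : HasDerivAtOne I (id : G → G) 1 :=
  ⟨rfl, hasMFDerivAt_id 1⟩

theorem HasDerivAtOne.one : HasDerivAtOne I (fun _ : G ↦ (1 : G)) 0 :=
  ⟨rfl, hasMFDerivAt_const 1 1⟩

theorem HasDerivAtOne.comp {f g : G → G} {A B : E →L[ℝ] E} (hf : HasDerivAtOne I f A)
    (hg : HasDerivAtOne I g B) : HasDerivAtOne I (f ∘ g) (A * B) := by
  refine ⟨by simp [hf.1, hg.1], ?_⟩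
  have hf2 : @HasMFDerivAt ℝ _ E _ _ H _ I G _ _ E _ _ H _ I G _ _ f (g 1) A := by
    rw [hg.1]; exact hf.2
  exact HasMFDerivAt.comp 1 hf2 hg.2

theorem HasDerivAtOne.iterate {f : G → G} {A : E →L[ℝ] E} (hf : HasDerivAtOne I f A) (n : ℕ) :
    HasDerivAtOne I f^[n] (A ^ n) := by
  induction n with
  | zero => exact HasDerivAtOne.id
  | succ n ih => exact pow_succ A n ▸ ih.comp hf

theorem hasDerivAtOne_of_contMDiff {f : G → G} (h1 : f 1 = 1) (hf : ContMDiff I I ∞ f) :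
    HasDerivAtOne I f (mfderiv I I f 1 : E →L[ℝ] E) :=
  ⟨h1, (hf.mdifferentiable (by simp) 1).hasMFDerivAt⟩

variable [LieGroup I ∞ G]

theorem HasDerivAtOne.mul {f g : G → G} {A B : E →L[ℝ] E} (hf : HasDerivAtOne I f A)
    (hg : HasDerivAtOne I g B) : HasDerivAtOne I (fun x ↦ f x * g x) (A + B) := by
  refine ⟨by simp [hf.1, hg.1], ?_⟩
  have hm : MDifferentiableAt (I.prod I) I (fun p : G × G ↦ p.1 * p.2) (1, 1) :=
    (contMDiff_mul I ∞).mdifferentiable (by simp) (1, 1)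
  have hm' : @HasMFDerivAt ℝ _ (E × E) _ _ (ModelProd H H) _ (I.prod I) (G × G) _ _ E _ _ H _ I G
      _ _ (fun p : G × G ↦ p.1 * p.2) (f 1, g 1)
      (ContinuousLinearMap.fst ℝ E E + ContinuousLinearMap.snd ℝ E E) := by
    rw [hf.1, hg.1]
    refine hm.hasMFDerivAt.congr_mfderiv ?_
    refine ContinuousLinearMap.ext fun v ↦ ?_
    refine (mfderiv_prod_eq_add_apply hm).trans ?_
    have d1 : HasDerivAtOne I (fun z : G ↦ z * 1) 1 := by
      simpa only [mul_one] using! HasDerivAtOne.id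
    have d2 : HasDerivAtOne I (fun z : G ↦ 1 * z) 1 := by
      simpa only [one_mul] using! HasDerivAtOne.id
    exact congrArg₂ (· + ·) (DFunLike.congr_fun d1.2.mfderiv v.1)
      (DFunLike.congr_fun d2.2.mfderiv v.2)
  exact HasMFDerivAt.comp 1 hm' (hf.2.prodMk hg.2)

theorem hasDerivAtOne_inv : HasDerivAtOne I (fun x : G ↦ x⁻¹) (-1) := by
  have h := hasDerivAtOne_of_contMDiff inv_one (contMDiff_inv I ∞ (G := G))
  have h0 := HasDerivAtOne.id.mul h
  have h1 : HasDerivAtOne I (fun x : G ↦ _root_.id x * x⁻¹) 0 := by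
    simpa using HasDerivAtOne.one (I := I) (G := G)
  rw [← eq_neg_of_add_eq_zero_right (h0.unique h1)]
  exact h

theorem contMDiff_conj (k : G) : ContMDiff I I ∞ (fun x : G ↦ k * x * k⁻¹) :=
  (contMDiff_const.mul contMDiff_id).mul contMDiff_const

variable (I) in
/-- The adjoint representation on the model space. -/
noncomputable def adjointOnModel (k : G) : E →L[ℝ] E :=
  mfderiv I I (fun x : G ↦ k * x * k⁻¹) 1

theorem hasDerivAtOne_conj (k : G) :
    HasDerivAtOne I (fun x : G ↦ k * x * k⁻¹) (adjointOnModel I k) :=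
  hasDerivAtOne_of_contMDiff (by simp) (contMDiff_conj k)

theorem adjointOnModel_pow (k : G) (m : ℕ) : adjointOnModel I (k ^ m) = adjointOnModel I k ^ m := by
  have hiter : (fun x : G ↦ k * x * k⁻¹)^[m] = fun x ↦ k ^ m * x * (k ^ m)⁻¹ := by
    induction m with
    | zero => ext; simp
    | succ m ih =>
      rw [Function.iterate_succ', ih]
      ext x
      simp [pow_succ', mul_assoc]
  exact (hasDerivAtOne_conj (k ^ m)).unique (hiter ▸ (hasDerivAtOne_conj k).iterate m)

theorem continuous_adjointOnModel : Continuous (adjointOnModel I : G → E →L[ℝ] E) := by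
  have : IsManifold I 1 G := IsManifold.of_le (n := ∞) (by simp)
  rw [continuous_iff_continuousAt]
  intro k₀
  have h := ContMDiffAt.mfderiv (I := I) (I' := I) (J := I) (x₀ := k₀) (n := ∞) (m := 0)
    (fun k x : G ↦ k * x * k⁻¹) (fun _ ↦ 1)
    (((contMDiff_fst.mul contMDiff_snd).mul contMDiff_fst.inv).contMDiffAt) contMDiffAt_const
    (by simp)
  refine h.continuousAt.congr (Filter.Eventually.of_forall fun k ↦ ?_)
  refine (inTangentCoordinates_eq (I := I) (I' := I) (fun _ : G ↦ (1 : G))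
    (fun x ↦ x * 1 * x⁻¹) (adjointOnModel I) (by simp) (by simp)).trans ?_
  -- Every conjugation fixes `1`, so the coordinate changes on both sides are between equal charts
  -- and act as the identity.
  have hself : ∀ a b : G, a = b → ∀ v : E,
      (tangentBundleCore I G).coordChange (achart H a) (achart H b) a v = v := by
    rintro a _ rfl v
    exact (tangentBundleCore I G).coordChange_self _ _ (mem_chart_source H a) v
  refine ContinuousLinearMap.ext fun v ↦ ?_
  refine (hself _ _ (by simp) _).trans ?_
  exact congrArg (adjointOnModel I k) (hself _ _ rfl v)

theorem isNilpotent_adjointOnModel_sub_one [Group.IsNilpotent G] (k : G) :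
    IsNilpotent (adjointOnModel I k - 1) := by
  refine ⟨Group.nilpotencyClass G, ?_⟩
  have h := ((hasDerivAtOne_conj (I := I) k).mul hasDerivAtOne_inv).iterate
    (Group.nilpotencyClass G)
  rw [funext fun x ↦ iterate_mul_conj_inv_eq_one k x, ← sub_eq_add_neg] at h
  exact h.unique HasDerivAtOne.one

theorem adjointOnModel_eq_one_of_mem_isCompact [Group.IsNilpotent G] {K : Subgroup G}
    (hK : IsCompact (K : Set G)) {k : G} (hk : k ∈ K) : adjointOnModel I k = 1 := by
  obtain ⟨C, hC⟩ := hK.exists_bound_of_continuousOn (continuous_adjointOnModel (I := I)).continuousOn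
  refine sub_eq_zero.mp (eq_zero_of_isNilpotent_of_bddAbove_norm_one_add_pow
    (isNilpotent_adjointOnModel_sub_one k) (C := C) fun m ↦ ?_)
  rw [add_sub_cancel, ← adjointOnModel_pow]
  exact hC _ (K.pow_mem hk m)

theorem mem_center_of_adjointOnModel_eq_one [I.Boundaryless] [ConnectedSpace G] {k : G}
    (hk : adjointOnModel I k = 1) : k ∈ Subgroup.center G := by
  have : IsManifold I 1 G := IsManifold.of_le (n := ∞) (by simp)
  set f : G → G := fun x ↦ k * x * k⁻¹ * x⁻¹ with hf
  have h1 : HasDerivAtOne I f 0 := by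
    have := (hasDerivAtOne_conj (I := I) k).mul hasDerivAtOne_inv
    rwa [hk, add_neg_cancel] at this
  have hder : ∀ x, HasMFDerivAt I I f x 0 := by
    intro x
    -- The commutator identity `f (x * y) = (k * x * k⁻¹) * f y * x⁻¹` carries the zero derivative
    -- from `1` to `x`.
    have hfx : f = (fun z ↦ k * x * k⁻¹ * z * x⁻¹) ∘ f ∘ (fun y ↦ x⁻¹ * y) := by
      ext y
      simp [hf, mul_assoc]
    have hR : MDifferentiableAt I I (fun y : G ↦ x⁻¹ * y) x :=
      (contMDiff_mul_left (I := I) (n := ∞)).mdifferentiable (by simp) x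
    have hL : MDifferentiable I I (fun z : G ↦ k * x * k⁻¹ * z * x⁻¹) :=
      ((contMDiff_const.mul contMDiff_id).mul contMDiff_const :
        ContMDiff I I ∞ _).mdifferentiable (by simp)
    have h2 : HasMFDerivAt I I f (x⁻¹ * x) 0 := by
      rw [inv_mul_cancel]; exact h1.2
    have h3 := HasMFDerivAt.comp x h2 hR.hasMFDerivAt
    rw [ContinuousLinearMap.zero_comp] at h3
    have h4 := HasMFDerivAt.comp x (hL _).hasMFDerivAt h3
    rw [ContinuousLinearMap.comp_zero] at h4
    rw [hfx]
    exact h4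
  rw [Subgroup.mem_center_iff]
  intro x
  have h := (IsLocallyConstant.of_hasMFDerivAt_zero hder).apply_eq_of_preconnectedSpace x 1
  rw [h1.1] at h
  exact (mul_inv_eq_iff_eq_mul.mp (mul_inv_eq_one.mp h)).symm

end

theorem mainTheorem7
    {E : Type*} [NormedAddCommGroup E] [NormedSpace ℝ E] [FiniteDimensional ℝ E]
    {H : Type*} [TopologicalSpace H] (I : ModelWithCorners ℝ E H) [I.Boundaryless]
    {N : Type*} [TopologicalSpace N] [T2Space N] [ChartedSpace H N] [Group N]
    [LieGroup I ∞ N] [ConnectedSpace N] [Group.IsNilpotent N]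
    (K : Subgroup N) (hK : IsCompact (K : Set N)) :
    K ≤ Subgroup.center N := fun _ hk ↦
  mem_center_of_adjointOnModel_eq_one (I := I) (adjointOnModel_eq_one_of_mem_isCompact hK hk)
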